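/- **Semi-circular graphs.** Let $G=(V,E)$ be a finite connected simple graph. A realization of $G$ as a semi-circular graph with $k\ge 1$ circles is a crossing-free drawing of $G$ in the plane, with edges drawn as simple arcs, together with circles $O_1,\dots,O_k$ centered at the origin, of radii $0<r_1<\dots<r_k$, such that: each $O_j$ carries exactly $m_j\ge 3$ vertices, and the subgraph of $G$ induced on them is the cycle $C_{m_j}$ whose edges are the arcs of $O_j$ between consecutive vertices; all other vertices lie in the open disk bounded by $O_1$; every edge between vertices on two different circles joins adjacent circles $O_i,O_{i+1}$ and lies in the closed annulus $r_i\le\sqrt{x^2+y^2}\le r_{i+1}$; and every edge with an end point inside $O_1$ lies in the closed disk bounded by $O_1$. Let $V_0$ be the set of vertices in the open disk bounded by $O_1$, and for $1\le i\le k$ let $V_i$ be the set of vertices in the closed disk bounded by $O_i$. Thus $V=V_k\supset\dots\supset V_1\supset V_0$, and $V_i\setminus V_{i-1}$ is the set of the $m_i$ vertices on $O_i$. **Notation.** Let $\mathrm{perfmat}\,G$ be the number of perfect matchings of $G$. For an orientation of the edges of $G$, let $S(G)=[s_{uv}]_{u,v\in V}$ be the skew symmetric matrix with $s_{uv}=1$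 if there is an edge directed from $u$ to $v$, $s_{uv}=-1$ if there is an edge directed from $v$ to $u$, and $s_{uv}=0$ otherwise. The orientation is pfaffian if $\det S(G)=(\mathrm{perfmat}\,G)^2$. For a matrix $B$ indexed by $V$ and $W\subseteq V$, let $B[W]$ be the principal submatrix of $B$ with rows and columns in $W$. For $n\ge 3$ let $T_{n,+}$ and $T_{n,-}$ be the skew symmetric matrices, defined as above, of the cycle $1-2-\dots-n-1$ with the edges oriented $1\to2\to\dots\to n$ and, respectively, $1\to n$ and $n\to 1$. Let $D_c(V_i\setminus V_{i-1})=\mathrm{diag}(d(w_1),\dots,d(w_{m_i}))$, where $w_1,\dots,w_{m_i}$ are the vertices on $O_i$ in cyclic order and $d$ is the degree in $G$. **Proposition.** Let $G$ be a connected semi-circular graph with a realization as above with $k>1$ circles, let $S(G)$ be given by a pfaffian orientation of $G$, and let $B=-S(G)^2$. Then $$\mathrm{perfmat}\,G\le(\det B[V_1])^{\frac14}\prod_{i=1}^{k-1}(\det B[V_{i+1}\setminus V_i])^{\frac14}.$$ Assume furthermore that $G$ has no $3$-cycles and no $4$-cycles, that for each $2\le i\le k$ every $u\in V_i\setminus V_{i-1}$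 is adjacent to at most one vertex of $V_{i-1}\setminus V_{i-2}$, and that for each $1\le i\le k-1$ every $u\in V_i\setminus V_{i-1}$ is adjacent to at most one vertex of $V_{i+1}\setminus V_i$. Then $m_i=|V_i\setminus V_{i-1}|>4$ for $1\le i\le k$; for $2\le i\le k$, $$\det B[V_i\setminus V_{i-1}]\le M_i:=\max_{\pm}\det\bigl(D_c(V_i\setminus V_{i-1})-2I_{m_i}-T_{m_i,\pm}^2\bigr);$$ and $$\mathrm{perfmat}\,G\le(\det B[V_1])^{\frac14}\prod_{i=2}^{k}M_i^{\frac14}.$$ -/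

import Mathlib

noncomputable section

namespace SemiCirc

/-- `perfmat G`: the number of perfect matchings of `G`. -/
def perfmat {V : Type*} (G : SimpleGraph V) : ℕ :=
  Nat.card {M : G.Subgraph // M.IsPerfectMatching}

/-- An orientation of the edges of a simple graph: every edge gets exactly one of its two
directions; `dir u v` says that the edge goes from `u` to `v`. -/
structure EdgeOrientation {V : Type*} (G : SimpleGraph V) where
  dir : V → V → Prop
  adj_of_dir : ∀ u v, dir u v → G.Adj u v
  dir_or_dir : ∀ u v, G.Adj u v → dir u v ∨ dir v u
  not_both : ∀ u v, dir u v → ¬ dir v u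

open Classical in
/-- The skew symmetric adjacency matrix `S(G)` of an oriented graph. -/
def EdgeOrientation.skewAdj {V : Type*} {G : SimpleGraph V} (o : EdgeOrientation G) :
    Matrix V V ℝ :=
  Matrix.of fun u v => if o.dir u v then 1 else if o.dir v u then -1 else 0

/-- An orientation is pfaffian if `det S(G) = (perfmat G)²`. -/
def EdgeOrientation.IsPfaffian {V : Type*} [Fintype V] [DecidableEq V] {G : SimpleGraph V}
    (o : EdgeOrientation G) : Prop :=
  o.skewAdj.det = (perfmat G : ℝ) ^ 2

/-- The principal submatrix `B[W]`. -/
def principal {V : Type*} (B : Matrix V V ℝ) (W : Finset V) : Matrix W W ℝ :=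
  B.submatrix Subtype.val Subtype.val

/-- A drawing of a simple graph in the plane `ℂ = ℝ²` without crossings: the vertices are
distinct points, every edge is a simple arc joining its two end points, an edge passes through no
vertex except its end points, and two different edges meet at common end points only. -/
structure PlaneDrawing {V : Type*} (G : SimpleGraph V) where
  pos : V → ℂ
  arc : Sym2 V → Set ℂ
  pos_injective : Function.Injective pos
  arc_simple : ∀ u v, G.Adj u v →
    ∃ γ : Path (pos u) (pos v), Function.Injective γ ∧ Set.range γ = arc s(u, v)
  mem_of_pos_mem_arc : ∀ e ∈ G.edgeSet, ∀ w, pos w ∈ arc e → w ∈ e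
  arc_inter : ∀ e ∈ G.edgeSet, ∀ f ∈ G.edgeSet, e ≠ f →
    arc e ∩ arc f ⊆ pos '' {w | w ∈ e ∧ w ∈ f}

/-- A realization of `G` as a semi-circular graph with `k` circles `O_1, …, O_k` centered at the
origin. All indexed data are meaningful for the indices `1, …, k` only (no condition is imposed on
the values at other indices).
The circle `O_j` has radius `radius j` and carries exactly the `m j ≥ 3` vertices
`cyc j 0, …, cyc j (m j - 1)`, listed counterclockwise, at the angles
`angle j 0 < … < angle j (m j - 1) < angle j (m j) = angle j 0 + 2π`.
All other vertices lie in the open disk bounded by `O_1`. -/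
structure SemiCircularDrawing {V : Type*} (G : SimpleGraph V) (k : ℕ)
    extends PlaneDrawing G where
  one_le_k : 1 ≤ k
  radius : ℕ → ℝ
  radius_pos : 0 < radius 1
  radius_strictMono : StrictMonoOn radius (Set.Icc 1 k)
  /-- The number of vertices on each circle. -/
  m : ℕ → ℕ
  three_le_m : ∀ j ∈ Set.Icc 1 k, 3 ≤ m j
  cyc : (j : ℕ) → Fin (m j) → V
  angle : ℕ → ℕ → ℝ
  angle_strictMono : ∀ j ∈ Set.Icc 1 k, StrictMonoOn (angle j) (Set.Icc 0 (m j))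
  angle_last : ∀ j ∈ Set.Icc 1 k, angle j (m j) = angle j 0 + 2 * Real.pi
  pos_cyc : ∀ j ∈ Set.Icc 1 k, ∀ t : Fin (m j),
    pos (cyc j t) = radius j * Complex.exp (angle j t * Complex.I)
  exists_cyc : ∀ j ∈ Set.Icc 1 k, ∀ v, ‖pos v‖ = radius j → ∃ t, cyc j t = v
  /-- Every vertex lies inside the first circle or on one of the circles. -/
  vertex_cases : ∀ v, ‖pos v‖ < radius 1 ∨ ∃ j ∈ Set.Icc 1 k, ‖pos v‖ = radius j
  /-- The subgraph induced on the vertices of `O_j` is the cycle in the order of `cyc j`. -/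
  adj_cyc : ∀ j ∈ Set.Icc 1 k, ∀ s t : Fin (m j),
    G.Adj (cyc j s) (cyc j t) ↔ (SimpleGraph.cycleGraph (m j)).Adj s t
  /-- The edges of this cycle are the arcs of `O_j` between consecutive vertices. -/
  arc_cyc : ∀ j ∈ Set.Icc 1 k, ∀ t : Fin (m j),
    arc s(cyc j t, cyc j (finRotate (m j) t)) =
      (fun φ : ℝ => (radius j : ℂ) * Complex.exp (φ * Complex.I)) ''
        Set.Icc (angle j t) (angle j (t + 1))
  /-- An edge between two different circles joins two adjacent circles and lies in the closed
  annulus between them. -/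
  annulus_edge : ∀ i ∈ Set.Icc 1 k, ∀ j ∈ Set.Icc 1 k, i < j → ∀ u v, G.Adj u v →
    ‖pos u‖ = radius i → ‖pos v‖ = radius j →
      j = i + 1 ∧ arc s(u, v) ⊆ {z | radius i ≤ ‖z‖ ∧ ‖z‖ ≤ radius j}
  /-- An edge at a vertex inside `O_1` stays in the closed disk bounded by `O_1`. -/
  disk_edge : ∀ u v, G.Adj u v → ‖pos u‖ < radius 1 →
    ‖pos v‖ ≤ radius 1 ∧ arc s(u, v) ⊆ {z | ‖z‖ ≤ radius 1}

/-- The sets `V_0, V_1, …, V_k`: `V_0` consists of the vertices in the open disk bounded by `O_1`,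
and `V_i`, for `1 ≤ i ≤ k`, of the vertices in the closed disk bounded by `O_i`. -/
def SemiCircularDrawing.Vset {V : Type*} [Fintype V] {G : SimpleGraph V} {k : ℕ}
    (C : SemiCircularDrawing G k) : ℕ → Finset V
  | 0 => Finset.univ.filter fun v => ‖C.pos v‖ < C.radius 1
  | i + 1 => Finset.univ.filter fun v => ‖C.pos v‖ ≤ C.radius (i + 1)

/-- The layer `V_i \ V_{i-1}`, for `1 ≤ i ≤ k`. -/
def SemiCircularDrawing.layer {V : Type*} [Fintype V] [DecidableEq V] {G : SimpleGraph V} {k : ℕ}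
    (C : SemiCircularDrawing G k) (i : ℕ) : Finset V :=
  C.Vset i \ C.Vset (i - 1)

/-- For `n ≥ 3`, the skew symmetric adjacency matrix of the `n`-cycle on the vertices
`0, 1, …, n - 1` with the edges oriented `0 → 1 → ⋯ → n - 1` and, for `ε = 1`, `0 → n - 1`, and
for `ε = -1`, `n - 1 → 0`. So `cycleSkew n 1` is `T_{n,+}` and `cycleSkew n (-1)` is `T_{n,-}`. -/
def cycleSkew (n : ℕ) (ε : ℝ) : Matrix (Fin n) (Fin n) ℝ :=
  Matrix.of fun s t =>
    if (s : ℕ) + 1 = t then 1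
    else if (t : ℕ) + 1 = s then -1
    else if (s : ℕ) = 0 ∧ (t : ℕ) + 1 = n then ε
    else if (t : ℕ) = 0 ∧ (s : ℕ) + 1 = n then -ε
    else 0

/-- The diagonal matrix `D_c(V_i \ V_{i-1})` of the degrees in `G` of the vertices on the `i`-th
circle, in the cyclic order. -/
def SemiCircularDrawing.degMatrix {V : Type*} [Fintype V] {G : SimpleGraph V} [DecidableRel G.Adj]
    {k : ℕ} (C : SemiCircularDrawing G k) (i : ℕ) : Matrix (Fin (C.m i)) (Fin (C.m i)) ℝ :=
  Matrix.diagonal fun t => (G.degree (C.cyc i t) : ℝ)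

/-- `max` over the two signs of `det (D_c(V_i \ V_{i-1}) - 2 I - T_{m_i,±}²)`. -/
def SemiCircularDrawing.layerBound {V : Type*} [Fintype V] {G : SimpleGraph V}
    [DecidableRel G.Adj] {k : ℕ} (C : SemiCircularDrawing G k) (i : ℕ) : ℝ :=
  max (C.degMatrix i - (2 : ℝ) • (1 : Matrix (Fin (C.m i)) (Fin (C.m i)) ℝ)
        - cycleSkew (C.m i) 1 ^ 2).det
      (C.degMatrix i - (2 : ℝ) • (1 : Matrix (Fin (C.m i)) (Fin (C.m i)) ℝ)
        - cycleSkew (C.m i) (-1) ^ 2).det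

end SemiCirc

end

/-! ### Determinants of positive semidefinite matrices and Fischer's inequality. -/

namespace Matrix

open scoped ComplexOrder MatrixOrder

/-! Skew symmetry makes `B = -S²` the Gram matrix `Sᵀ S`, so `B` is positive semidefinite, and the
pfaffian orientation gives `det B = (perfmat G)⁴`. Fischer's inequality, applied along the chain
`V_1 ⊂ ⋯ ⊂ V_k` (`det_le_prod_layers`), bounds `det B` by the product of the layer determinants;
fourth roots give the first estimate.

For the second, the entry of `B` at `u, v` is a signed count of common neighbours. Under the two
adjacency conditions, distinct vertices of `O_i`, `i ≥ 2`, have common neighbours on `O_i` only.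
Hence the block of `B` on that layer is `D_c - 2I - T²`, where `T` is the skew matrix of the
oriented cycle (`principal_layer_eq`). A diagonal sign change turns `T` into `T_{m,+}` or `T_{m,-}`
(`exists_switching`) without changing the determinant. -/

theorem PosSemidef.one_le_det_one_add {n : Type*} [Fintype n] [DecidableEq n]
    {Q : Matrix n n ℝ} (hQ : Q.PosSemidef) : 1 ≤ (1 + Q).det := by
  have h : 1 + Q = Unitary.conjStarAlgAut ℝ _ hQ.1.eigenvectorUnitary
      (1 + diagonal (RCLike.ofReal ∘ hQ.1.eigenvalues)) := by
    rw [map_add, map_one, ← hQ.1.spectral_theorem]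
  have h2 : (1 + Q).det = ∏ i, (1 + hQ.1.eigenvalues i) := by
    rw [h, Unitary.conjStarAlgAut_apply, det_mul_right_comm, ← diagonal_one, diagonal_add]
    simp
  rw [h2]
  calc (1 : ℝ) = ∏ _i : n, 1 := Finset.prod_const_one.symm
    _ ≤ _ := Finset.prod_le_prod (fun _ _ => zero_le_one) fun i _ =>
      le_add_of_nonneg_right (hQ.eigenvalues_nonneg i)

/-- For invertible `X` and `P = Nᴴ N`, the matrix determinant lemma gives `det (X + P) = det X * det
(1 + N X⁻¹ Nᴴ)`, and the second factor is at least `1`. -/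
theorem PosSemidef.det_le_det_add {n : Type*} [Fintype n] [DecidableEq n]
    {X P : Matrix n n ℝ} (hX : X.PosSemidef) (hP : P.PosSemidef) : X.det ≤ (X + P).det := by
  by_cases h0 : X.det = 0
  · rw [h0]
    exact (hX.add hP).det_nonneg
  obtain ⟨N, hN⟩ := CStarAlgebra.nonneg_iff_eq_star_mul_self.mp hP.nonneg
  rw [star_eq_conjTranspose] at hN
  rw [hN, det_add_mul _ _ (isUnit_iff_ne_zero.mpr h0)]
  exact le_mul_of_one_le_right hX.det_nonneg
    (hX.inv.mul_mul_conjTranspose_same N).one_le_det_one_add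

/-- **Fischer's inequality** for a matrix in block form. -/
theorem PosSemidef.det_fromBlocks_le {m n : Type*} [Fintype m] [DecidableEq m] [Fintype n]
    [DecidableEq n] {A : Matrix m m ℝ} {B : Matrix m n ℝ} {D : Matrix n n ℝ}
    (h : (fromBlocks A B Bᴴ D).PosSemidef) :
    (fromBlocks A B Bᴴ D).det ≤ A.det * D.det := by
  have hA : A.PosSemidef := h.submatrix Sum.inl
  have hD : D.PosSemidef := h.submatrix Sum.inr
  by_cases h0 : (fromBlocks A B Bᴴ D).det = 0
  · rw [h0]
    exact mul_nonneg hA.det_nonneg hD.det_nonneg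
  have hpd : A.PosDef := (h.posDef_iff_det_ne_zero.mpr h0).submatrix Sum.inl_injective
  have := invertibleOfIsUnitDet A (isUnit_iff_ne_zero.mpr hpd.det_pos.ne')
  rw [det_fromBlocks₁₁, invOf_eq_nonsing_inv]
  refine mul_le_mul_of_nonneg_left ?_ hA.det_nonneg
  -- The Schur complement `D - Bᴴ A⁻¹ B` is positive semidefinite, and adding the positive
  -- semidefinite `Bᴴ A⁻¹ B` to it gives `D`.
  have hS := (PosDef.fromBlocks₁₁ B D hpd).mp h
  simpa using hS.det_le_det_add (hA.inv.conjTranspose_mul_mul_same B)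

end Matrix

/-! ### The skew adjacency matrix and its Gram matrix. -/

namespace SemiCirc

open Matrix

variable {V : Type*} {G : SimpleGraph V}

theorem EdgeOrientation.skewAdj_swap (o : EdgeOrientation G) (u v : V) :
    o.skewAdj u v = -o.skewAdj v u := by
  have := o.not_both u v
  simp only [skewAdj, of_apply]
  split_ifs <;> simp_all

theorem EdgeOrientation.skewAdj_transpose (o : EdgeOrientation G) :
    o.skewAdjᵀ = -o.skewAdj := by
  ext u v
  exact o.skewAdj_swap v u

theorem EdgeOrientation.skewAdj_of_not_adj (o : EdgeOrientation G) {u v : V} (h : ¬ G.Adj u v) :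
    o.skewAdj u v = 0 := by
  have h1 : ¬ o.dir u v := fun hd => h (o.adj_of_dir _ _ hd)
  have h2 : ¬ o.dir v u := fun hd => h (o.adj_of_dir _ _ hd).symm
  simp [skewAdj, h1, h2]

theorem EdgeOrientation.skewAdj_mul_self_of_adj (o : EdgeOrientation G) {u v : V}
    (h : G.Adj u v) : o.skewAdj u v * o.skewAdj u v = 1 := by
  rcases o.dir_or_dir _ _ h with h1 | h1 <;> simp only [skewAdj, of_apply] <;> split_ifs <;> simp

theorem principal_posSemidef {B : Matrix V V ℝ} (hB : B.PosSemidef) (W : Finset V) :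
    (principal B W).PosSemidef :=
  hB.submatrix _

variable [DecidableEq V]

/-- **Fischer's inequality** for principal submatrices. -/
theorem det_principal_le {B : Matrix V V ℝ} (hB : B.PosSemidef) {W U : Finset V} (h : W ⊆ U) :
    (principal B U).det ≤ (principal B W).det * (principal B (U \ W)).det := by
  let f : W ⊕ ↥(U \ W) → U := Sum.elim (fun w => ⟨w, h w.2⟩) fun w => ⟨w, (Finset.mem_sdiff.mp w.2).1⟩
  have hf : f.Bijective := by
    constructor
    · rintro (⟨a, ha⟩ | ⟨a, ha⟩) (⟨b, hb⟩ | ⟨b, hb⟩) hab <;>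
        obtain rfl : a = b := congrArg Subtype.val hab
      · rfl
      · exact absurd ha (Finset.mem_sdiff.mp hb).2
      · exact absurd hb (Finset.mem_sdiff.mp ha).2
      · rfl
    · rintro ⟨a, ha⟩
      by_cases haW : a ∈ W
      · exact ⟨Sum.inl ⟨a, haW⟩, rfl⟩
      · exact ⟨Sum.inr ⟨a, Finset.mem_sdiff.mpr ⟨ha, haW⟩⟩, rfl⟩
  let e := Equiv.ofBijective f hf
  have hblock : (principal B U).submatrix e e =
      fromBlocks (principal B W) (B.submatrix Subtype.val Subtype.val)
        (B.submatrix Subtype.val Subtype.val)ᴴ (principal B (U \ W)) := by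
    ext (i | i) (j | j)
    · rfl
    · rfl
    · exact (hB.1.apply _ _).symm
    · rfl
  have hps : ((principal B U).submatrix e e).PosSemidef := (principal_posSemidef hB U).submatrix _
  rw [← det_submatrix_equiv_self e]
  rw [hblock] at hps ⊢
  exact hps.det_fromBlocks_le

variable [Fintype V]

theorem EdgeOrientation.neg_sq_eq (o : EdgeOrientation G) :
    -(o.skewAdj ^ 2) = o.skewAdjᴴ * o.skewAdj := by
  rw [conjTranspose_eq_transpose_of_trivial, o.skewAdj_transpose, neg_mul, sq]

theorem EdgeOrientation.posSemidef_neg_sq (o : EdgeOrientation G) :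
    (-(o.skewAdj ^ 2)).PosSemidef := by
  rw [o.neg_sq_eq]
  exact posSemidef_conjTranspose_mul_self _

theorem EdgeOrientation.IsPfaffian.perfmat_eq {o : EdgeOrientation G} (ho : o.IsPfaffian) :
    (perfmat G : ℝ) = (-(o.skewAdj ^ 2)).det ^ (1 / 4 : ℝ) := by
  have h : (-(o.skewAdj ^ 2)).det = (perfmat G : ℝ) ^ 4 := by
    rw [o.neg_sq_eq, det_mul, conjTranspose_eq_transpose_of_trivial, det_transpose, ho]
    ring
  rw [h]
  have := Real.pow_rpow_inv_natCast (Nat.cast_nonneg (perfmat G) : (0 : ℝ) ≤ perfmat G)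
    (n := 4) (by norm_num)
  rw [one_div]
  exact_mod_cast this.symm

end SemiCirc

/-! ### Oriented cycles up to switching, and short cycles. -/

namespace SemiCirc

open Matrix

theorem cycleGraph_adj_iff {n : ℕ} (hn : 3 ≤ n) (s t : Fin n) :
    (SimpleGraph.cycleGraph n).Adj s t ↔
      (s : ℕ) + 1 = t ∨ (t : ℕ) + 1 = s ∨ ((s : ℕ) = 0 ∧ (t : ℕ) + 1 = n) ∨
        ((t : ℕ) = 0 ∧ (s : ℕ) + 1 = n) := by
  rw [SimpleGraph.cycleGraph_adj']
  have hs := s.2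
  have ht := t.2
  rcases lt_trichotomy s t with h | h | h
  · rw [Fin.coe_sub_iff_lt.mpr h, Fin.sub_val_of_le h.le]
    have : (s : ℕ) < t := h
    omega
  · subst h
    rw [Fin.sub_val_of_le le_rfl]
    omega
  · rw [Fin.coe_sub_iff_lt.mpr h, Fin.sub_val_of_le h.le]
    have : (t : ℕ) < s := h
    omega

theorem cycleGraph_degree {n : ℕ} (hn : 3 ≤ n) (s : Fin n) :
    (SimpleGraph.cycleGraph n).degree s = 2 := by
  obtain ⟨n, rfl⟩ := Nat.exists_eq_add_of_le' hn
  exact SimpleGraph.cycleGraph_degree_three_le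

/-- A signed skew symmetric adjacency matrix of a cycle is switching equivalent to one of the two
matrices `cycleSkew n (±1)`. -/
theorem exists_switching {n : ℕ} (hn : 3 ≤ n) {T : Matrix (Fin n) (Fin n) ℝ}
    (hskew : ∀ s t, T s t = -T t s)
    (hadj : ∀ s t, (SimpleGraph.cycleGraph n).Adj s t → T s t * T s t = 1)
    (hnadj : ∀ s t, ¬ (SimpleGraph.cycleGraph n).Adj s t → T s t = 0) :
    ∃ (d : Fin n → ℝ) (ε : ℝ), (ε = 1 ∨ ε = -1) ∧ (∀ s, d s * d s = 1) ∧
      T = diagonal d * cycleSkew n ε * diagonal d := by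
  -- `τ j` is the sign of the edge from `j` to `j + 1`; the default `1` keeps `τ j ^ 2 = 1` for
  -- every `j`. Switching by the partial products `δ` makes all path edges positive, and only the
  -- sign of the closing edge remains: this is `ε`.
  let τ : ℕ → ℝ := fun j => if h : j + 1 < n then T ⟨j, by omega⟩ ⟨j + 1, h⟩ else 1
  let δ : ℕ → ℝ := fun j => ∏ x ∈ Finset.range j, τ x
  have hτ : ∀ s t : Fin n, (s : ℕ) + 1 = t → τ s = T s t := by
    intro s t h
    have ht := t.2
    simp only [τ, dif_pos (show (s : ℕ) + 1 < n by omega)]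
    congr 1
    exact Fin.ext h
  have hτ2 : ∀ j, τ j * τ j = 1 := by
    intro j
    by_cases h : j + 1 < n
    · rw [hτ ⟨j, by omega⟩ ⟨j + 1, h⟩ rfl]
      exact hadj _ _ ((cycleGraph_adj_iff hn _ _).mpr (Or.inl rfl))
    · simp [τ, h]
  have hδ2 : ∀ j, δ j * δ j = 1 := by
    intro j
    simp only [δ, ← Finset.prod_mul_distrib, hτ2, Finset.prod_const_one]
  have hδs : ∀ j, δ (j + 1) = δ j * τ j := fun j => Finset.prod_range_succ _ _
  let a : Fin n := ⟨0, by omega⟩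
  let b : Fin n := ⟨n - 1, by omega⟩
  have hab : T a b * T a b = 1 :=
    hadj _ _ ((cycleGraph_adj_iff hn _ _).mpr (Or.inr (Or.inr (Or.inl ⟨rfl, by simp [b]; omega⟩))))
  refine ⟨fun s => δ s, δ a * T a b * δ b, ?_, fun s => hδ2 s, ?_⟩
  · have h : (δ a * T a b * δ b) * (δ a * T a b * δ b) = 1 := by
      linear_combination (δ b * δ b) * (T a b * T a b) * hδ2 a + (δ b * δ b) * hab + hδ2 b
    exact mul_self_eq_one_iff.mp h
  · ext s t
    rw [mul_diagonal, diagonal_mul]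
    have hlast : ∀ s t : Fin n, (s : ℕ) = 0 → (t : ℕ) + 1 = n →
        T s t = δ s * (δ a * T a b * δ b) * δ t := by
      intro s t hs ht
      obtain rfl : s = a := Fin.ext hs
      obtain rfl : t = b := Fin.ext (by simp [b]; omega)
      linear_combination -(δ b * δ b) * T a b * hδ2 a - T a b * hδ2 b
    have hstep : ∀ s t : Fin n, (s : ℕ) + 1 = t → T s t = δ s * δ t := by
      intro s t h
      rw [← h, hδs, hτ s t h]
      linear_combination -T s t * hδ2 s
    simp only [cycleSkew, of_apply]
    split_ifs with h1 h2 h3 h4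
    · rw [hstep s t h1]
      ring
    · rw [hskew, hstep t s h2]
      ring
    · exact hlast s t h3.1 h3.2
    · rw [hskew, hlast t s h4.1 h4.2]
      ring
    · rw [hnadj s t (by rw [cycleGraph_adj_iff hn]; tauto)]
      ring

/-- `diagonal d` is its own inverse and commutes with `diagonal e`, so the two matrices are
conjugate. -/
theorem det_sub_sq_switching {n : ℕ} (d : Fin n → ℝ) (hd : ∀ s, d s * d s = 1) (e : Fin n → ℝ)
    (C : Matrix (Fin n) (Fin n) ℝ) :
    (diagonal e - (diagonal d * C * diagonal d) ^ 2).det = (diagonal e - C ^ 2).det := by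
  have hdd : diagonal d * diagonal d = 1 := by
    rw [diagonal_mul_diagonal]
    simp [hd]
  have h1 : (diagonal d * C * diagonal d) ^ 2 = diagonal d * C ^ 2 * diagonal d := by
    calc (diagonal d * C * diagonal d) ^ 2
        = diagonal d * C * (diagonal d * diagonal d) * C * diagonal d := by
          simp only [sq, Matrix.mul_assoc]
      _ = diagonal d * C ^ 2 * diagonal d := by
          rw [hdd]
          simp only [sq, Matrix.mul_assoc, Matrix.one_mul]
  have h2 : diagonal e = diagonal d * diagonal e * diagonal d := by
    rw [diagonal_mul_diagonal, diagonal_mul_diagonal]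
    congr 1
    ext s
    linear_combination -e s * hd s
  rw [h1]
  conv_lhs => rw [h2]
  rw [← Matrix.sub_mul, ← Matrix.mul_sub, det_mul_right_comm, hdd, Matrix.one_mul]

section Cycles

variable {V : Type*} {G : SimpleGraph V}

theorem not_triangle (h : ∀ (v : V) (c : G.Walk v v), c.IsCycle → c.length ≠ 3 ∧ c.length ≠ 4)
    {a b c : V} (hab : G.Adj a b) (hbc : G.Adj b c) (hca : G.Adj c a) : False := by
  refine (h a (.cons hab (.cons hbc (.cons hca .nil))) ?_).1 rfl
  have := hab.ne
  have := hbc.ne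
  have := hca.ne
  simp [SimpleGraph.Walk.cons_isCycle_iff]
  grind

theorem not_square (h : ∀ (v : V) (c : G.Walk v v), c.IsCycle → c.length ≠ 3 ∧ c.length ≠ 4)
    {a b c d : V} (hab : G.Adj a b) (hbc : G.Adj b c) (hcd : G.Adj c d) (hda : G.Adj d a)
    (hac : a ≠ c) (hbd : b ≠ d) : False := by
  refine (h a (.cons hab (.cons hbc (.cons hcd (.cons hda .nil)))) ?_).2 rfl
  have := hab.ne
  have := hbc.ne
  have := hcd.ne
  have := hda.ne
  simp [SimpleGraph.Walk.cons_isCycle_iff]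
  grind

end Cycles

end SemiCirc

/-! ### Circles, layers and their blocks of `B`. -/

namespace SemiCirc.SemiCircularDrawing

open Matrix

variable {V : Type*} {G : SimpleGraph V} {k : ℕ} (C : SemiCircularDrawing G k)

theorem radius_pos_of_mem {i : ℕ} (hi : i ∈ Set.Icc 1 k) : 0 < C.radius i :=
  C.radius_pos.trans_le (C.radius_strictMono.monotoneOn ⟨le_rfl, C.one_le_k⟩ hi hi.1)

theorem norm_pos_cyc {i : ℕ} (hi : i ∈ Set.Icc 1 k) (t : Fin (C.m i)) :
    ‖C.pos (C.cyc i t)‖ = C.radius i := by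
  rw [C.pos_cyc i hi t, norm_mul, Complex.norm_exp_ofReal_mul_I, mul_one, Complex.norm_real,
    Real.norm_of_nonneg (C.radius_pos_of_mem hi).le]

theorem cyc_injective {i : ℕ} (hi : i ∈ Set.Icc 1 k) : Function.Injective (C.cyc i) := by
  intro s t hst
  have h := congrArg C.pos hst
  rw [C.pos_cyc i hi, C.pos_cyc i hi] at h
  have hr : (C.radius i : ℂ) ≠ 0 := by exact_mod_cast (C.radius_pos_of_mem hi).ne'
  obtain ⟨N, hN⟩ := Complex.exp_eq_exp_iff_exists_int.mp (mul_left_cancel₀ hr h)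
  have hN' : C.angle i s = C.angle i t + N * (2 * Real.pi) := by
    have h2 : ((C.angle i s : ℝ) : ℂ) = ((C.angle i t + N * (2 * Real.pi) : ℝ) : ℂ) := by
      push_cast
      exact mul_right_cancel₀ Complex.I_ne_zero (by linear_combination hN)
    exact_mod_cast h2
  have hmono := C.angle_strictMono i hi
  have hrange : ∀ x : Fin (C.m i), C.angle i 0 ≤ C.angle i x ∧
      C.angle i x < C.angle i 0 + 2 * Real.pi := by
    intro x
    rw [← C.angle_last i hi]
    exact ⟨hmono.monotoneOn ⟨le_rfl, Nat.zero_le _⟩ ⟨Nat.zero_le _, x.2.le⟩ (Nat.zero_le _),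
      hmono ⟨Nat.zero_le _, x.2.le⟩ ⟨Nat.zero_le _, le_rfl⟩ x.2⟩
  have hs := hrange s
  have ht := hrange t
  have hpi := Real.pi_pos
  -- Both angles lie in one half-open interval of length `2π`, so they cannot differ by a nonzero
  -- multiple of `2π`.
  have h1 : (N : ℝ) < 1 := by nlinarith
  have h2 : (-1 : ℝ) < N := by nlinarith
  have hN0 : N = 0 := by
    have : N < 1 := by exact_mod_cast h1
    have : -1 < N := by exact_mod_cast h2
    omega
  rw [hN0] at hN'
  exact Fin.ext (hmono.injOn ⟨Nat.zero_le _, s.2.le⟩ ⟨Nat.zero_le _, t.2.le⟩ (by simpa using hN'))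

section Layers

variable [Fintype V]

theorem mem_Vset {i : ℕ} (hi : 1 ≤ i) (v : V) : v ∈ C.Vset i ↔ ‖C.pos v‖ ≤ C.radius i := by
  obtain ⟨i, rfl⟩ := Nat.exists_eq_add_of_le' hi
  simp [Vset]

theorem Vset_subset_Vset_succ {i : ℕ} (hi : 1 ≤ i) (hik : i + 1 ≤ k) :
    C.Vset i ⊆ C.Vset (i + 1) := by
  intro v hv
  rw [C.mem_Vset hi] at hv
  rw [C.mem_Vset (by omega)]
  exact hv.trans (C.radius_strictMono ⟨hi, by omega⟩ ⟨by omega, hik⟩ (Nat.lt_succ_self i)).le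

theorem Vset_last : C.Vset k = Finset.univ := by
  have hk := C.one_le_k
  ext v
  simp only [C.mem_Vset hk, Finset.mem_univ, iff_true]
  rcases C.vertex_cases v with h | ⟨j, hj, h⟩
  · exact h.le.trans (C.radius_strictMono.monotoneOn ⟨le_rfl, hk⟩ ⟨hk, le_rfl⟩ hk)
  · exact h.le.trans (C.radius_strictMono.monotoneOn hj ⟨hk, le_rfl⟩ hj.2)

variable [DecidableEq V]

theorem mem_layer {i : ℕ} (hi : i ∈ Set.Icc 1 k) (v : V) :
    v ∈ C.layer i ↔ ‖C.pos v‖ = C.radius i := by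
  have hk := C.one_le_k
  rw [layer, Finset.mem_sdiff, C.mem_Vset hi.1]
  -- The innermost layer is separate because `V_0` is cut out by a strict inequality, unlike the
  -- other `V_i`.
  rcases eq_or_lt_of_le hi.1 with rfl | h1
  · simp only [Nat.sub_self, Vset, Finset.mem_filter, Finset.mem_univ, true_and, not_lt]
    exact le_antisymm_iff.symm
  have hpred : i - 1 ∈ Set.Icc 1 k := ⟨by omega, by have := hi.2; omega⟩
  have hlt : C.radius (i - 1) < C.radius i := C.radius_strictMono hpred hi (by omega)
  rw [C.mem_Vset hpred.1, not_le]
  refine ⟨fun ⟨h2, h3⟩ => ?_, fun h => ⟨h.le, h ▸ hlt⟩⟩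
  rcases C.vertex_cases v with h | ⟨j, hj, h⟩
  · exact absurd (h3.trans h)
      (C.radius_strictMono.monotoneOn ⟨le_rfl, hk⟩ hpred hpred.1).not_gt
  · rw [h] at h2 h3 ⊢
    have h4 := (C.radius_strictMono.le_iff_le hj hi).mp h2
    have h5 := (C.radius_strictMono.lt_iff_lt hpred hj).mp h3
    rw [show j = i by omega]

theorem cyc_mem_layer {i : ℕ} (hi : i ∈ Set.Icc 1 k) (t : Fin (C.m i)) :
    C.cyc i t ∈ C.layer i :=
  (C.mem_layer hi _).mpr (C.norm_pos_cyc hi t)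

theorem exists_cyc_of_mem_layer {i : ℕ} (hi : i ∈ Set.Icc 1 k) {v : V} (hv : v ∈ C.layer i) :
    ∃ t, C.cyc i t = v :=
  C.exists_cyc i hi v ((C.mem_layer hi _).mp hv)

/-- The vertices of a circle, listed in their cyclic order. -/
noncomputable def cycEquiv {i : ℕ} (hi : i ∈ Set.Icc 1 k) : Fin (C.m i) ≃ C.layer i :=
  Equiv.ofBijective (fun t => ⟨C.cyc i t, C.cyc_mem_layer hi t⟩)
    ⟨fun _ _ h => C.cyc_injective hi (congrArg Subtype.val h), fun ⟨_, hv⟩ =>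
      (C.exists_cyc_of_mem_layer hi hv).imp fun _ h => Subtype.ext h⟩

theorem card_layer {i : ℕ} (hi : i ∈ Set.Icc 1 k) : (C.layer i).card = C.m i := by
  simpa using (Fintype.card_congr (C.cycEquiv hi)).symm

/-- `i ≥ 2` excludes neighbours inside `O_1`, whose edges stay in the disk bounded by `O_1`. -/
theorem exists_layer_of_adj {i : ℕ} (hi : i ∈ Set.Icc 2 k) {u w : V} (hu : u ∈ C.layer i)
    (huw : G.Adj u w) :
    w ∈ C.layer i ∨ w ∈ C.layer (i - 1) ∨ (i + 1 ≤ k ∧ w ∈ C.layer (i + 1)) := by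
  have hk := C.one_le_k
  have hi2 := hi.1
  have hik := hi.2
  have hi1 : i ∈ Set.Icc 1 k := ⟨by omega, hik⟩
  rw [C.mem_layer hi1] at hu
  rcases C.vertex_cases w with h | ⟨j, hj, h⟩
  · have := (C.disk_edge w u huw.symm h).1
    rw [hu] at this
    exact absurd this (C.radius_strictMono ⟨le_rfl, hk⟩ hi1 (by omega)).not_ge
  · rcases lt_trichotomy i j with hij | rfl | hij
    · obtain ⟨rfl, -⟩ := C.annulus_edge i hi1 j hj hij u w huw hu h
      exact Or.inr (Or.inr ⟨hj.2, (C.mem_layer hj w).mpr h⟩)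
    · exact Or.inl ((C.mem_layer hj w).mpr h)
    · obtain ⟨rfl, -⟩ := C.annulus_edge j hj i hi1 hij w u huw.symm h hu
      exact Or.inr (Or.inl ((C.mem_layer hj w).mpr h))

variable [DecidableRel G.Adj]

/-- A common neighbour on `O_{i-1}` or `O_{i+1}` would have two neighbours on `O_i`, against the
outward or the inward condition respectively. -/
theorem mem_layer_of_common_neighbor
    (hin : ∀ i ∈ Finset.Icc 2 k, ∀ u ∈ C.layer i,
      ((C.layer (i - 1)).filter fun v => G.Adj u v).card ≤ 1)
    (hout : ∀ i ∈ Finset.Icc 1 (k - 1), ∀ u ∈ C.layer i,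
      ((C.layer (i + 1)).filter fun v => G.Adj u v).card ≤ 1)
    {i : ℕ} (hi : i ∈ Set.Icc 2 k) {u v w : V} (hu : u ∈ C.layer i) (hv : v ∈ C.layer i)
    (huv : u ≠ v) (hwu : G.Adj w u) (hwv : G.Adj w v) : w ∈ C.layer i := by
  have hi2 := hi.1
  have hik := hi.2
  rcases C.exists_layer_of_adj hi hu hwu.symm with h | h | ⟨hk, h⟩
  · exact h
  · have := hout (i - 1) (Finset.mem_Icc.mpr ⟨by omega, by omega⟩) w h
    rw [Nat.sub_add_cancel (by omega)] at this
    exact absurd (Finset.card_le_one.mp this u (by simp [hu, hwu]) v (by simp [hv, hwv])) huv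
  · have := hin (i + 1) (Finset.mem_Icc.mpr ⟨by omega, hk⟩) w h
    rw [Nat.add_sub_cancel] at this
    exact absurd (Finset.card_le_one.mp this u (by simp [hu, hwu]) v (by simp [hv, hwv])) huv

/-- Off the diagonal, both sides sum over the same common neighbours, all on `O_i`. On the diagonal,
`B` has the degree in `G`, while `-T²` contributes the degree `2` in the cycle, which `-2I` cancels.
-/
theorem principal_layer_eq (o : EdgeOrientation G)
    (hin : ∀ i ∈ Finset.Icc 2 k, ∀ u ∈ C.layer i,
      ((C.layer (i - 1)).filter fun v => G.Adj u v).card ≤ 1)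
    (hout : ∀ i ∈ Finset.Icc 1 (k - 1), ∀ u ∈ C.layer i,
      ((C.layer (i + 1)).filter fun v => G.Adj u v).card ≤ 1)
    {i : ℕ} (hi : i ∈ Set.Icc 2 k) (hi1 : i ∈ Set.Icc 1 k) :
    (principal (-(o.skewAdj ^ 2)) (C.layer i)).submatrix (C.cycEquiv hi1) (C.cycEquiv hi1) =
      C.degMatrix i - (2 : ℝ) • (1 : Matrix (Fin (C.m i)) (Fin (C.m i)) ℝ)
        - (o.skewAdj.submatrix (C.cyc i) (C.cyc i)) ^ 2 := by
  classical
  have hsq : ∀ s t, ((o.skewAdj.submatrix (C.cyc i) (C.cyc i)) ^ 2) s t =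
      -∑ x, o.skewAdj (C.cyc i x) (C.cyc i s) * o.skewAdj (C.cyc i x) (C.cyc i t) := by
    intro s t
    rw [sq, mul_apply, ← Finset.sum_neg_distrib]
    refine Finset.sum_congr rfl fun x _ => ?_
    rw [submatrix_apply, submatrix_apply, o.skewAdj_swap (C.cyc i s)]
    ring
  have hself : ∀ u v, o.skewAdj u v * o.skewAdj u v = if G.Adj v u then 1 else 0 := by
    intro u v
    split_ifs with h
    · exact o.skewAdj_mul_self_of_adj h.symm
    · rw [o.skewAdj_of_not_adj fun h' => h h'.symm, mul_zero]
  ext s t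
  have hL : (principal (-(o.skewAdj ^ 2)) (C.layer i)).submatrix (C.cycEquiv hi1)
      (C.cycEquiv hi1) s t =
      ∑ w, o.skewAdj w (C.cyc i s) * o.skewAdj w (C.cyc i t) := by
    rw [o.neg_sq_eq]
    rfl
  rw [hL, Matrix.sub_apply, Matrix.sub_apply, hsq, Matrix.smul_apply]
  by_cases hst : s = t
  · subst hst
    simp only [hself, C.adj_cyc i hi1, Finset.sum_boole, ← SimpleGraph.neighborFinset_eq_filter,
      SimpleGraph.card_neighborFinset_eq_degree, degMatrix, diagonal_apply_eq, one_apply_eq]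
    rw [cycleGraph_degree (C.three_le_m i hi1)]
    simp
  · rw [degMatrix, diagonal_apply_ne _ hst, one_apply_ne hst, smul_zero, sub_zero, zero_sub,
      neg_neg]
    -- The sum over all of `V` reduces to the vertices of the circle, since a nonzero term needs a
    -- common neighbour.
    refine (Finset.sum_of_injOn (C.cyc i) (C.cyc_injective hi1).injOn (by simp) ?_
      fun _ _ => rfl).symm
    intro w _ hw
    by_contra h0
    have h1 : G.Adj w (C.cyc i s) := by
      by_contra h
      exact h0 (by rw [o.skewAdj_of_not_adj h, zero_mul])
    have h2 : G.Adj w (C.cyc i t) := by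
      by_contra h
      exact h0 (by rw [o.skewAdj_of_not_adj h, mul_zero])
    obtain ⟨x, rfl⟩ := C.exists_cyc_of_mem_layer hi1 (C.mem_layer_of_common_neighbor hin hout hi
      (C.cyc_mem_layer hi1 s) (C.cyc_mem_layer hi1 t) ((C.cyc_injective hi1).ne hst) h1 h2)
    exact hw (by simp)

theorem det_principal_layer_le (o : EdgeOrientation G)
    (hin : ∀ i ∈ Finset.Icc 2 k, ∀ u ∈ C.layer i,
      ((C.layer (i - 1)).filter fun v => G.Adj u v).card ≤ 1)
    (hout : ∀ i ∈ Finset.Icc 1 (k - 1), ∀ u ∈ C.layer i,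
      ((C.layer (i + 1)).filter fun v => G.Adj u v).card ≤ 1)
    {i : ℕ} (hi : i ∈ Set.Icc 2 k) :
    (principal (-(o.skewAdj ^ 2)) (C.layer i)).det ≤ C.layerBound i := by
  have hi1 : i ∈ Set.Icc 1 k := ⟨one_le_two.trans hi.1, hi.2⟩
  rw [← det_submatrix_equiv_self (C.cycEquiv hi1), C.principal_layer_eq o hin hout hi hi1]
  obtain ⟨d, ε, hε, hd, hT⟩ := exists_switching (C.three_le_m i hi1)
    (T := o.skewAdj.submatrix (C.cyc i) (C.cyc i)) (fun s t => o.skewAdj_swap _ _)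
    (fun s t h => o.skewAdj_mul_self_of_adj ((C.adj_cyc i hi1 s t).mpr h))
    (fun s t h => o.skewAdj_of_not_adj fun h' => h ((C.adj_cyc i hi1 s t).mp h'))
  have hdiag : C.degMatrix i - (2 : ℝ) • (1 : Matrix (Fin (C.m i)) (Fin (C.m i)) ℝ) =
      diagonal fun t => (G.degree (C.cyc i t) : ℝ) - 2 := by
    rw [degMatrix, smul_one_eq_diagonal, diagonal_sub]
  rw [layerBound, hT, hdiag, det_sub_sq_switching d hd]
  rcases hε with rfl | rfl
  · exact le_max_left _ _
  · exact le_max_right _ _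

omit [Fintype V] [DecidableEq V] [DecidableRel G.Adj] in
-- With three or four vertices, the circle would itself be a forbidden cycle.
theorem four_lt_m
    (hcyc : ∀ (v : V) (c : G.Walk v v), c.IsCycle → c.length ≠ 3 ∧ c.length ≠ 4)
    {i : ℕ} (hi : i ∈ Set.Icc 1 k) : 4 < C.m i := by
  have h3 := C.three_le_m i hi
  have hadj : ∀ a b : Fin (C.m i), ((a : ℕ) + 1 = b ∨ ((b : ℕ) = 0 ∧ (a : ℕ) + 1 = C.m i)) →
      G.Adj (C.cyc i a) (C.cyc i b) := by
    intro a b h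
    rw [C.adj_cyc i hi, cycleGraph_adj_iff h3]
    tauto
  have hne : ∀ a b : Fin (C.m i), (a : ℕ) ≠ b → C.cyc i a ≠ C.cyc i b := fun a b h =>
    (C.cyc_injective hi).ne fun h' => h (congrArg Fin.val h')
  by_contra hlt
  rcases (show C.m i = 3 ∨ C.m i = 4 by omega) with hm | hm
  · exact not_triangle hcyc (hadj ⟨0, by omega⟩ ⟨1, by omega⟩ (by simp))
      (hadj _ ⟨2, by omega⟩ (by simp)) (hadj _ _ (by simp [hm]))
  · exact not_square hcyc (hadj ⟨0, by omega⟩ ⟨1, by omega⟩ (by simp))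
      (hadj _ ⟨2, by omega⟩ (by simp)) (hadj _ ⟨3, by omega⟩ (by simp))
      (hadj _ _ (by simp [hm])) (hne _ _ (by simp)) (hne _ _ (by simp))

end Layers

/-! ### The product bounds. -/

theorem det_le_prod_layers [Fintype V] [DecidableEq V] {B : Matrix V V ℝ} (hB : B.PosSemidef) :
    B.det ≤ (principal B (C.Vset 1)).det *
      ∏ i ∈ Finset.Icc 1 (k - 1), (principal B (C.Vset (i + 1) \ C.Vset i)).det := by
  have key : ∀ j, j + 1 ≤ k → (principal B (C.Vset (j + 1))).det ≤
      (principal B (C.Vset 1)).det *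
        ∏ i ∈ Finset.Icc 1 j, (principal B (C.Vset (i + 1) \ C.Vset i)).det := by
    intro j
    induction j with
    | zero => simp
    | succ j ih =>
      intro hj
      rw [Finset.prod_Icc_succ_top (by omega), ← mul_assoc]
      -- Fischer's inequality splits off the outermost layer; its determinant is nonnegative, so it
      -- can multiply the inductive bound.
      exact (det_principal_le hB (C.Vset_subset_Vset_succ (by omega) hj)).trans
        (mul_le_mul_of_nonneg_right (ih (by omega)) (principal_posSemidef hB _).det_nonneg)
  have h := key (k - 1) (by have := C.one_le_k; omega)
  rw [Nat.sub_add_cancel C.one_le_k, C.Vset_last] at h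
  refine le_of_eq_of_le ?_ h
  exact det_submatrix_equiv_self (Equiv.subtypeUnivEquiv Finset.mem_univ).symm
    (principal B Finset.univ)

theorem perfmat_le [Fintype V] [DecidableEq V] {o : EdgeOrientation G} (ho : o.IsPfaffian) :
    (perfmat G : ℝ) ≤ (principal (-(o.skewAdj ^ 2)) (C.Vset 1)).det ^ (1 / 4 : ℝ) *
      ∏ i ∈ Finset.Icc 1 (k - 1),
        (principal (-(o.skewAdj ^ 2)) (C.Vset (i + 1) \ C.Vset i)).det ^ (1 / 4 : ℝ) := by
  have hB := o.posSemidef_neg_sq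
  rw [ho.perfmat_eq, Real.finsetProd_rpow _ _ fun i _ => (principal_posSemidef hB _).det_nonneg,
    ← Real.mul_rpow (principal_posSemidef hB _).det_nonneg
      (Finset.prod_nonneg fun i _ => (principal_posSemidef hB _).det_nonneg)]
  exact Real.rpow_le_rpow hB.det_nonneg (C.det_le_prod_layers hB) (by norm_num)

end SemiCirc.SemiCircularDrawing

theorem proposition6p3 {V : Type*} [Fintype V] [DecidableEq V] (G : SimpleGraph V)
    [DecidableRel G.Adj] (hG : G.Connected) (k : ℕ) (hk : 1 < k)
    (C : SemiCirc.SemiCircularDrawing G k)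
    (o : SemiCirc.EdgeOrientation G) (ho : o.IsPfaffian)
    (B : Matrix V V ℝ) (hB : B = -(o.skewAdj ^ 2)) :
    ((SemiCirc.perfmat G : ℝ) ≤
      (SemiCirc.principal B (C.Vset 1)).det ^ (1 / 4 : ℝ) *
        ∏ i ∈ Finset.Icc 1 (k - 1),
          (SemiCirc.principal B (C.Vset (i + 1) \ C.Vset i)).det ^ (1 / 4 : ℝ)) ∧
    ((∀ (v : V) (c : G.Walk v v), c.IsCycle → c.length ≠ 3 ∧ c.length ≠ 4) →
      (∀ i ∈ Finset.Icc 2 k, ∀ u ∈ C.layer i,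
        ((C.layer (i - 1)).filter fun v => G.Adj u v).card ≤ 1) →
      (∀ i ∈ Finset.Icc 1 (k - 1), ∀ u ∈ C.layer i,
        ((C.layer (i + 1)).filter fun v => G.Adj u v).card ≤ 1) →
      (∀ i ∈ Finset.Icc 1 k, (C.layer i).card = C.m i ∧ 4 < C.m i) ∧
      (∀ i ∈ Finset.Icc 2 k,
        (SemiCirc.principal B (C.layer i)).det ≤ C.layerBound i) ∧
      (SemiCirc.perfmat G : ℝ) ≤
        (SemiCirc.principal B (C.Vset 1)).det ^ (1 / 4 : ℝ) *
          ∏ i ∈ Finset.Icc 2 k, C.layerBound i ^ (1 / 4 : ℝ)) := by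
  subst hB
  refine ⟨C.perfmat_le ho, fun hcyc hin hout => ?_⟩
  have hlayer : ∀ i ∈ Finset.Icc 2 k,
      (SemiCirc.principal (-(o.skewAdj ^ 2)) (C.layer i)).det ≤ C.layerBound i := fun i hi =>
    C.det_principal_layer_le o hin hout (Finset.mem_Icc.mp hi)
  refine ⟨fun i hi => ⟨C.card_layer (Finset.mem_Icc.mp hi),
    C.four_lt_m hcyc (Finset.mem_Icc.mp hi)⟩, hlayer, (C.perfmat_le ho).trans ?_⟩
  have hps := o.posSemidef_neg_sq
  refine mul_le_mul_of_nonneg_left ?_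
    (Real.rpow_nonneg (SemiCirc.principal_posSemidef hps _).det_nonneg _)
  have hIcc : Finset.Icc 2 k = (Finset.Icc 1 (k - 1)).map (addRightEmbedding 1) := by
    rw [Finset.map_add_right_Icc, Nat.sub_add_cancel hk.le]
  rw [hIcc, Finset.prod_map]
  refine Finset.prod_le_prod
    (fun i _ => Real.rpow_nonneg (SemiCirc.principal_posSemidef hps _).det_nonneg _)
    fun i hi => ?_
  -- After the index shift, `C.layer (i + 1)` is `C.Vset (i + 1) \ C.Vset i` by definition, because
  -- `i + 1 - 1` reduces to `i`.
  refine Real.rpow_le_rpow (SemiCirc.principal_posSemidef hps _).det_nonneg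
    (hlayer (i + 1) ?_) (by norm_num)
  rw [Finset.mem_Icc] at hi ⊢
  omega
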